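/- Formulas are built from a denumerable set of propositional variables. Nelson's calculus $\mathcal S$, in the language $\langle\land,\lor,\Rightarrow,\neg,0\rangle$, has the axiom schemata $\varphi\Rightarrow\varphi$; $\;0\Rightarrow\psi$; $\;\neg\varphi\Rightarrow(\varphi\Rightarrow 0)$; $\;\neg 0$; $\;(\varphi\Rightarrow\psi)\Leftrightarrow(\neg\psi\Rightarrow\neg\varphi)$, where $\alpha\Leftrightarrow\beta:=(\alpha\Rightarrow\beta)\land(\beta\Rightarrow\alpha)$. For a finite (possibly empty) list $\Gamma=(\varphi_1,\dots,\varphi_n)$ write $\Gamma\Rightarrow\varphi:=\varphi_1\Rightarrow(\varphi_2\Rightarrow(\cdots\Rightarrow(\varphi_n\Rightarrow\varphi)\cdots))$, write $\alpha\Rightarrow^2\beta:=\alpha\Rightarrow(\alpha\Rightarrow\beta)$, and define $\Gamma\Rightarrow^2\varphi$ likewise from $\Rightarrow^2$. The rule schemata of $\mathcal S$ (premises / conclusion), for every such $\Gamma$, are: - $\Gamma\Rightarrow(\varphi\Rightarrow(\psi\Rightarrow\gamma))\;/\;\Gamma\Rightarrow(\psi\Rightarrow(\varphi\Rightarrow\gamma))$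 - $\varphi\Rightarrow(\varphi\Rightarrow(\varphi\Rightarrow\gamma))\;/\;\varphi\Rightarrow(\varphi\Rightarrow\gamma)$ - $\Gamma\Rightarrow\varphi,\ \varphi\Rightarrow\gamma\;/\;\Gamma\Rightarrow\gamma$ - $\Gamma\Rightarrow\varphi,\ \psi\Rightarrow\gamma\;/\;\Gamma\Rightarrow((\varphi\Rightarrow\psi)\Rightarrow\gamma)$ - $\gamma\;/\;\varphi\Rightarrow\gamma$ - $\varphi\Rightarrow\gamma\;/\;(\varphi\land\psi)\Rightarrow\gamma$ and $\psi\Rightarrow\gamma\;/\;(\varphi\land\psi)\Rightarrow\gamma$ - $\Gamma\Rightarrow\varphi,\ \Gamma\Rightarrow\psi\;/\;\Gamma\Rightarrow(\varphi\land\psi)$ - $\varphi\Rightarrow\gamma,\ \psi\Rightarrow\gamma\;/\;(\varphi\lor\psi)\Rightarrow\gamma$ - $\varphi\Rightarrow^2\gamma,\ \psi\Rightarrow^2\gamma\;/\;(\varphi\lor\psi)\Rightarrow^2\gamma$ - $\Gamma\Rightarrow\varphi\;/\;\Gamma\Rightarrow(\varphi\lor\psi)$ and $\Gamma\Rightarrow\psi\;/\;\Gamma\Rightarrow(\varphi\lor\psi)$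 - $(\varphi\land\neg\psi)\Rightarrow\gamma\;/\;\neg(\varphi\Rightarrow\psi)\Rightarrow\gamma$ and $\Gamma\Rightarrow^2(\varphi\land\neg\psi)\;/\;\Gamma\Rightarrow^2\neg(\varphi\Rightarrow\psi)$ - $(\neg\varphi\lor\neg\psi)\Rightarrow\gamma\;/\;\neg(\varphi\land\psi)\Rightarrow\gamma$ and $\Gamma\Rightarrow(\neg\varphi\lor\neg\psi)\;/\;\Gamma\Rightarrow\neg(\varphi\land\psi)$ - $(\neg\varphi\land\neg\psi)\Rightarrow\gamma\;/\;\neg(\varphi\lor\psi)\Rightarrow\gamma$ and $\Gamma\Rightarrow(\neg\varphi\land\neg\psi)\;/\;\Gamma\Rightarrow\neg(\varphi\lor\psi)$ - $\varphi\Rightarrow\gamma\;/\;\neg\neg\varphi\Rightarrow\gamma$ and $\Gamma\Rightarrow\varphi\;/\;\Gamma\Rightarrow\neg\neg\varphi$ The calculus $\mathcal S'$, in the language $\langle\land,\lor,*,\Rightarrow,0,1\rangle$, has modus ponens (from $\varphi$ and $\varphi\Rightarrow\psi$ infer $\psi$) as its only rule schema and the fifteen axiom schemata 1. $(\varphi\Rightarrow\psi)\Rightarrow((\psi\Rightarrow\gamma)\Rightarrow(\varphi\Rightarrow\gamma))$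 2. $(\varphi\Rightarrow(\psi\Rightarrow\gamma))\Rightarrow(\psi\Rightarrow(\varphi\Rightarrow\gamma))$ 3. $\varphi\Rightarrow(\psi\Rightarrow\varphi)$ 4. $\varphi\Rightarrow(\psi\Rightarrow(\varphi*\psi))$ 5. $(\varphi\Rightarrow(\psi\Rightarrow\gamma))\Rightarrow((\varphi*\psi)\Rightarrow\gamma)$ 6. $(\varphi\land\psi)\Rightarrow\varphi$ 7. $(\varphi\land\psi)\Rightarrow\psi$ 8. $(\varphi\Rightarrow\psi)\Rightarrow((\varphi\Rightarrow\gamma)\Rightarrow(\varphi\Rightarrow(\psi\land\gamma)))$ 9. $\varphi\Rightarrow(\varphi\lor\psi)$ 10. $\psi\Rightarrow(\varphi\lor\psi)$ 11. $(\varphi\Rightarrow\gamma)\Rightarrow((\psi\Rightarrow\gamma)\Rightarrow((\varphi\lor\psi)\Rightarrow\gamma))$ 12. $1$ 13. $0\Rightarrow\varphi$ 14. $((\varphi\Rightarrow 0)\Rightarrow 0)\Rightarrow\varphi$ 15. $(\varphi\Rightarrow(\varphi\Rightarrow(\varphi\Rightarrow\psi)))\Rightarrow(\varphi\Rightarrow(\varphi\Rightarrow\psi))$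 In both calculi, $\varphi$ is a consequence of a (possibly infinite) set $T$ of formulas if it has a finite derivation from members of $T$. Consider formulas of the expanded language $\langle\land,\lor,\Rightarrow,*,\neg,0,1\rangle$. Read in $\mathcal S$, the connectives $1$ and $*$ abbreviate $1:=\neg 0$ and $\varphi*\psi:=\neg(\varphi\Rightarrow\neg\psi)$; read in $\mathcal S'$, the connective $\neg$ abbreviates $\neg\varphi:=\varphi\Rightarrow 0$. **Corollary.** (i) $\mathcal S$ and $\mathcal S'$ define the same consequence relation: for every set $T$ of formulas and every formula $\varphi$ of the expanded language, $T\vdash_{\mathcal S}\varphi$ if and only if $T\vdash_{\mathcal S'}\varphi$. (ii) Hence $\mathcal S$ is finitely axiomatizable with modus ponens as its only rule: there is a finite set of axiom schemata in the language $\langle\land,\lor,\Rightarrow,\neg,0\rangle$ which, together with modus ponens as the only rule schema, defines the consequence relation $\vdash_{\mathcal S}$. -/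

import Mathlib

/-- Formulas of the language `⟨∧, ∨, ⇒, ¬, 0⟩` of Nelson's logic `S`, over the denumerable set of
propositional variables `var 0, var 1, …`. -/
inductive SFormula : Type
  | var (n : ℕ) : SFormula
  | and (φ ψ : SFormula) : SFormula
  | or (φ ψ : SFormula) : SFormula
  | imp (φ ψ : SFormula) : SFormula
  | neg (φ : SFormula) : SFormula
  | zero : SFormula

infixr:60 " ⇒ₛ " => SFormula.imp
infixr:66 " ∧ₛ " => SFormula.and
infixr:65 " ∨ₛ " => SFormula.or
prefix:max "¬ₛ" => SFormula.neg

/-- Formulas of the language `⟨∧, ∨, *, ⇒, 0, 1⟩` of the logic `S′`. -/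
inductive SPrimeFormula : Type
  | var (n : ℕ) : SPrimeFormula
  | and (φ ψ : SPrimeFormula) : SPrimeFormula
  | or (φ ψ : SPrimeFormula) : SPrimeFormula
  | mul (φ ψ : SPrimeFormula) : SPrimeFormula
  | imp (φ ψ : SPrimeFormula) : SPrimeFormula
  | zero : SPrimeFormula
  | one : SPrimeFormula

infixr:60 " ⇒ₚ " => SPrimeFormula.imp
infixr:66 " ∧ₚ " => SPrimeFormula.and
infixr:65 " ∨ₚ " => SPrimeFormula.or
infixr:70 " *ₚ " => SPrimeFormula.mul

/-- Formulas of the common expanded language `⟨∧, ∨, ⇒, *, ¬, 0, 1⟩`. -/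
inductive ExpFormula : Type
  | var (n : ℕ) : ExpFormula
  | and (φ ψ : ExpFormula) : ExpFormula
  | or (φ ψ : ExpFormula) : ExpFormula
  | imp (φ ψ : ExpFormula) : ExpFormula
  | mul (φ ψ : ExpFormula) : ExpFormula
  | neg (φ : ExpFormula) : ExpFormula
  | zero : ExpFormula
  | one : ExpFormula

namespace SFormula

/-- `1 := ¬0`. -/
def one : SFormula := ¬ₛzero

/-- `φ * ψ := ¬(φ ⇒ ¬ψ)`. -/
def mul (φ ψ : SFormula) : SFormula := ¬ₛ(φ ⇒ₛ ¬ₛψ)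

/-- `φ ⇔ ψ := (φ ⇒ ψ) ∧ (ψ ⇒ φ)`. -/
def iff (φ ψ : SFormula) : SFormula := (φ ⇒ₛ ψ) ∧ₛ (ψ ⇒ₛ φ)

/-- `φ ⇒² ψ := φ ⇒ (φ ⇒ ψ)`. -/
def imp2 (φ ψ : SFormula) : SFormula := φ ⇒ₛ (φ ⇒ₛ ψ)

/-- `Γ ⇒ φ := φ₁ ⇒ (φ₂ ⇒ (… ⇒ (φₙ ⇒ φ)…))` for a finite list `Γ = (φ₁, …, φₙ)`;
it is `φ` if `Γ` is empty. -/
def impList (Γ : List SFormula) (φ : SFormula) : SFormula := Γ.foldr imp φ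

/-- `Γ ⇒² φ := φ₁ ⇒² (φ₂ ⇒² (… ⇒² (φₙ ⇒² φ)…))`. -/
def imp2List (Γ : List SFormula) (φ : SFormula) : SFormula := Γ.foldr imp2 φ

/-- Simultaneous substitution. -/
def subst (σ : ℕ → SFormula) : SFormula → SFormula
  | var n => σ n
  | and φ ψ => and (subst σ φ) (subst σ ψ)
  | or φ ψ => or (subst σ φ) (subst σ ψ)
  | imp φ ψ => imp (subst σ φ) (subst σ ψ)
  | neg φ => neg (subst σ φ)
  | zero => zero

end SFormula

/-- Simultaneous substitution. -/
def SPrimeFormula.subst (σ : ℕ → SPrimeFormula) : SPrimeFormula → SPrimeFormula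
  | var n => σ n
  | and φ ψ => and (subst σ φ) (subst σ ψ)
  | or φ ψ => or (subst σ φ) (subst σ ψ)
  | mul φ ψ => mul (subst σ φ) (subst σ ψ)
  | imp φ ψ => imp (subst σ φ) (subst σ ψ)
  | zero => zero
  | one => one

/-- `SDerives T φ`: the formula `φ` is derivable from the set `T` of assumptions in Nelson's
calculus for `S`. In the rules that mention it, `Γ` is an arbitrary finite list of formulas. -/
inductive SDerives (T : Set SFormula) : SFormula → Prop
  | hyp {φ} : φ ∈ T → SDerives T φ
  | A1 (φ) : SDerives T (φ ⇒ₛ φ)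
  | A2 (ψ) : SDerives T (.zero ⇒ₛ ψ)
  | A3 (φ) : SDerives T (¬ₛφ ⇒ₛ (φ ⇒ₛ .zero))
  | A4 : SDerives T .one
  | A5 (φ ψ) : SDerives T (.iff (φ ⇒ₛ ψ) (¬ₛψ ⇒ₛ ¬ₛφ))
  | P (Γ : List SFormula) {φ ψ γ} :
      SDerives T (.impList Γ (φ ⇒ₛ (ψ ⇒ₛ γ))) → SDerives T (.impList Γ (ψ ⇒ₛ (φ ⇒ₛ γ)))
  | C {φ γ} : SDerives T (φ ⇒ₛ (φ ⇒ₛ (φ ⇒ₛ γ))) → SDerives T (φ ⇒ₛ (φ ⇒ₛ γ))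
  | E (Γ : List SFormula) {φ γ} :
      SDerives T (.impList Γ φ) → SDerives T (φ ⇒ₛ γ) → SDerives T (.impList Γ γ)
  | impL (Γ : List SFormula) {φ ψ γ} :
      SDerives T (.impList Γ φ) → SDerives T (ψ ⇒ₛ γ) →
        SDerives T (.impList Γ ((φ ⇒ₛ ψ) ⇒ₛ γ))
  | impR (φ) {γ} : SDerives T γ → SDerives T (φ ⇒ₛ γ)
  | andL1 {φ γ} (ψ) : SDerives T (φ ⇒ₛ γ) → SDerives T ((φ ∧ₛ ψ) ⇒ₛ γ)
  | andL2 (φ) {ψ γ} : SDerives T (ψ ⇒ₛ γ) → SDerives T ((φ ∧ₛ ψ) ⇒ₛ γ)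
  | andR (Γ : List SFormula) {φ ψ} :
      SDerives T (.impList Γ φ) → SDerives T (.impList Γ ψ) → SDerives T (.impList Γ (φ ∧ₛ ψ))
  | orL1 {φ ψ γ} :
      SDerives T (φ ⇒ₛ γ) → SDerives T (ψ ⇒ₛ γ) → SDerives T ((φ ∨ₛ ψ) ⇒ₛ γ)
  | orL2 {φ ψ γ} :
      SDerives T (.imp2 φ γ) → SDerives T (.imp2 ψ γ) → SDerives T (.imp2 (φ ∨ₛ ψ) γ)
  | orR1 (Γ : List SFormula) {φ} (ψ) :
      SDerives T (.impList Γ φ) → SDerives T (.impList Γ (φ ∨ₛ ψ))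
  | orR2 (Γ : List SFormula) (φ) {ψ} :
      SDerives T (.impList Γ ψ) → SDerives T (.impList Γ (φ ∨ₛ ψ))
  | negImpL {φ ψ γ} :
      SDerives T ((φ ∧ₛ ¬ₛψ) ⇒ₛ γ) → SDerives T (¬ₛ(φ ⇒ₛ ψ) ⇒ₛ γ)
  | negImpR (Γ : List SFormula) {φ ψ} :
      SDerives T (.imp2List Γ (φ ∧ₛ ¬ₛψ)) → SDerives T (.imp2List Γ (¬ₛ(φ ⇒ₛ ψ)))
  | negAndL {φ ψ γ} :
      SDerives T ((¬ₛφ ∨ₛ ¬ₛψ) ⇒ₛ γ) → SDerives T (¬ₛ(φ ∧ₛ ψ) ⇒ₛ γ)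
  | negAndR (Γ : List SFormula) {φ ψ} :
      SDerives T (.impList Γ (¬ₛφ ∨ₛ ¬ₛψ)) → SDerives T (.impList Γ (¬ₛ(φ ∧ₛ ψ)))
  | negOrL {φ ψ γ} :
      SDerives T ((¬ₛφ ∧ₛ ¬ₛψ) ⇒ₛ γ) → SDerives T (¬ₛ(φ ∨ₛ ψ) ⇒ₛ γ)
  | negOrR (Γ : List SFormula) {φ ψ} :
      SDerives T (.impList Γ (¬ₛφ ∧ₛ ¬ₛψ)) → SDerives T (.impList Γ (¬ₛ(φ ∨ₛ ψ)))
  | negNegL {φ γ} : SDerives T (φ ⇒ₛ γ) → SDerives T (¬ₛ¬ₛφ ⇒ₛ γ)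
  | negNegR (Γ : List SFormula) {φ} :
      SDerives T (.impList Γ φ) → SDerives T (.impList Γ (¬ₛ¬ₛφ))

/-- Derivability from the assumptions `T` in the Hilbert-style calculus whose axioms are the
members of `Ax` and whose only rule is modus ponens for the implication `imp`. -/
inductive MPDerives {F : Type} (imp : F → F → F) (Ax T : Set F) : F → Prop
  | hyp {φ} : φ ∈ T → MPDerives imp Ax T φ
  | ax {φ} : φ ∈ Ax → MPDerives imp Ax T φ
  | mp {φ ψ} : MPDerives imp Ax T φ → MPDerives imp Ax T (imp φ ψ) → MPDerives imp Ax T ψ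

/-- The fifteen axiom schemata of `S′`, written with three variables `φ = var 0`, `ψ = var 1`,
`γ = var 2`. -/
def sPrimeSchemata : Set SPrimeFormula :=
  let φ : SPrimeFormula := .var 0
  let ψ : SPrimeFormula := .var 1
  let γ : SPrimeFormula := .var 2
  { (φ ⇒ₚ ψ) ⇒ₚ ((ψ ⇒ₚ γ) ⇒ₚ (φ ⇒ₚ γ)),
    (φ ⇒ₚ (ψ ⇒ₚ γ)) ⇒ₚ (ψ ⇒ₚ (φ ⇒ₚ γ)),
    φ ⇒ₚ (ψ ⇒ₚ φ),
    φ ⇒ₚ (ψ ⇒ₚ (φ *ₚ ψ)),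
    (φ ⇒ₚ (ψ ⇒ₚ γ)) ⇒ₚ ((φ *ₚ ψ) ⇒ₚ γ),
    (φ ∧ₚ ψ) ⇒ₚ φ,
    (φ ∧ₚ ψ) ⇒ₚ ψ,
    (φ ⇒ₚ ψ) ⇒ₚ ((φ ⇒ₚ γ) ⇒ₚ (φ ⇒ₚ (ψ ∧ₚ γ))),
    φ ⇒ₚ (φ ∨ₚ ψ),
    ψ ⇒ₚ (φ ∨ₚ ψ),
    (φ ⇒ₚ γ) ⇒ₚ ((ψ ⇒ₚ γ) ⇒ₚ ((φ ∨ₚ ψ) ⇒ₚ γ)),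
    .one,
    .zero ⇒ₚ φ,
    ((φ ⇒ₚ .zero) ⇒ₚ .zero) ⇒ₚ φ,
    (φ ⇒ₚ (φ ⇒ₚ (φ ⇒ₚ ψ))) ⇒ₚ (φ ⇒ₚ (φ ⇒ₚ ψ)) }

/-- The consequence relation of `S′`: all instances of the fifteen schemata, and modus ponens. -/
def SPrimeDerives (T : Set SPrimeFormula) (φ : SPrimeFormula) : Prop :=
  MPDerives SPrimeFormula.imp {χ | ∃ α ∈ sPrimeSchemata, ∃ σ, χ = α.subst σ} T φ

/-- The formula of the language of `S` that a formula of the expanded language abbreviates: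
`1 := ¬0` and `φ * ψ := ¬(φ ⇒ ¬ψ)`. -/
def ExpFormula.toS : ExpFormula → SFormula
  | var n => .var n
  | and φ ψ => .and φ.toS ψ.toS
  | or φ ψ => .or φ.toS ψ.toS
  | imp φ ψ => .imp φ.toS ψ.toS
  | mul φ ψ => .mul φ.toS ψ.toS
  | neg φ => .neg φ.toS
  | zero => .zero
  | one => .one

/-- The formula of the language of `S′` that a formula of the expanded language abbreviates:
`¬φ := φ ⇒ 0`. -/
def ExpFormula.toSPrime : ExpFormula → SPrimeFormula
  | var n => .var n
  | and φ ψ => .and φ.toSPrime ψ.toSPrime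
  | or φ ψ => .or φ.toSPrime ψ.toSPrime
  | imp φ ψ => .imp φ.toSPrime ψ.toSPrime
  | mul φ ψ => .mul φ.toSPrime ψ.toSPrime
  | neg φ => .imp φ.toSPrime .zero
  | zero => .zero
  | one => .one

/-- The consequence relation of `S` in the expanded language, `1` and `*` being defined. -/
def SConsequence (T : Set ExpFormula) (φ : ExpFormula) : Prop :=
  SDerives (ExpFormula.toS '' T) φ.toS

/-- The consequence relation of `S′` in the expanded language, `¬` being defined. -/
def SPrimeConsequence (T : Set ExpFormula) (φ : ExpFormula) : Prop :=
  SPrimeDerives (ExpFormula.toSPrime '' T) φ.toSPrime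

/-!
Both consequence relations are compared with *theories*: sets of formulas of the expanded language
that are closed under modus ponens and contain all instances of the fifteen schemata of `S′` together
with `¬φ ⇔ (φ ⇒ 0)`. Such a set is the filter of designated elements of a bounded, involutive,
integral, commutative, 3-potent residuated lattice of formulas preordered by `⊢ φ ⇒ ψ`.

* The consequences in `S′`, and those in `S`, form a theory (`SPrimeConsequence.isTheory`,
  `SConsequence.isTheory`). For `S` the one delicate schema is 3-potency, since Nelson's contraction
  is only a rule, without side formulas: contraction applied to `φ ⇒ (φ ⇒ (φ ⇒ φ³))`, where `φ³` is
  `φ * (φ * φ)`, gives `φ ⇒ (φ ⇒ φ³)`, while `φ ⇒ (φ ⇒ (φ ⇒ ψ))` entails `φ³ ⇒ ψ`.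
* Every theory is closed under the rules of `S` (`IsTheory.of_sDerives`). Two rules need 3-potency:
  left introduction of `∨` under `⇒²`, because each of the monomials of `(φ ∨ ψ)³` contains `φ²` or
  `ψ²`; and right introduction of `¬(φ ⇒ ψ)` under `⇒²`, because `φ ∧ ¬ψ` squared lies below
  `φ * ¬ψ`, and squares are idempotent, so the hypotheses in `Γ` can be used twice.
* In a theory the defined connectives are equivalent to their definitions, so that each formula is
  equivalent to its reading in `S` and to its reading in `S′` (`IsTheory.eqv_ofS_toS`,
  `IsTheory.eqv_ofSPrime_toSPrime`).

The equality of the two relations follows, and the seventeen schemata, read in the language of `S`,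
axiomatize `S` with modus ponens alone.
-/

/-! ### Theories in the expanded language -/

local infixr:60 " ⇒ₑ " => ExpFormula.imp
local infixr:66 " ∧ₑ " => ExpFormula.and
local infixr:65 " ∨ₑ " => ExpFormula.or
local infixr:70 " *ₑ " => ExpFormula.mul
local prefix:max "¬ₑ" => ExpFormula.neg

/-- A theory: a set of formulas of the expanded language closed under modus ponens and containing
the axioms of `S′` and the two halves of `¬φ ⇔ (φ ⇒ 0)`. -/
structure IsTheory (D : ExpFormula → Prop) : Prop where
  mp {a b} : D a → D (a ⇒ₑ b) → D b
  suffixing (a b c) : D ((a ⇒ₑ b) ⇒ₑ ((b ⇒ₑ c) ⇒ₑ (a ⇒ₑ c)))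
  exchange (a b c) : D ((a ⇒ₑ (b ⇒ₑ c)) ⇒ₑ (b ⇒ₑ (a ⇒ₑ c)))
  weakening (a b) : D (a ⇒ₑ (b ⇒ₑ a))
  mul_intro (a b) : D (a ⇒ₑ (b ⇒ₑ (a *ₑ b)))
  mul_elim (a b c) : D ((a ⇒ₑ (b ⇒ₑ c)) ⇒ₑ ((a *ₑ b) ⇒ₑ c))
  and_left (a b) : D ((a ∧ₑ b) ⇒ₑ a)
  and_right (a b) : D ((a ∧ₑ b) ⇒ₑ b)
  and_intro (a b c) : D ((a ⇒ₑ b) ⇒ₑ ((a ⇒ₑ c) ⇒ₑ (a ⇒ₑ (b ∧ₑ c))))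
  or_left (a b) : D (a ⇒ₑ (a ∨ₑ b))
  or_right (a b) : D (b ⇒ₑ (a ∨ₑ b))
  or_elim (a b c) : D ((a ⇒ₑ c) ⇒ₑ ((b ⇒ₑ c) ⇒ₑ ((a ∨ₑ b) ⇒ₑ c)))
  one : D .one
  zero_imp (a) : D (.zero ⇒ₑ a)
  imp_zero_imp_zero (a) : D (((a ⇒ₑ .zero) ⇒ₑ .zero) ⇒ₑ a)
  contraction (a b) : D ((a ⇒ₑ (a ⇒ₑ (a ⇒ₑ b))) ⇒ₑ (a ⇒ₑ (a ⇒ₑ b)))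
  neg_imp (a) : D (¬ₑa ⇒ₑ (a ⇒ₑ .zero))
  imp_neg (a) : D ((a ⇒ₑ .zero) ⇒ₑ ¬ₑa)

namespace IsTheory

variable {D : ExpFormula → Prop} (h : IsTheory D) {a b c d : ExpFormula}
include h

/-! ### Elementary consequences -/

theorem swap (H : D (a ⇒ₑ (b ⇒ₑ c))) : D (b ⇒ₑ (a ⇒ₑ c)) := h.mp H (h.exchange _ _ _)

theorem wk (b) (H : D a) : D (b ⇒ₑ a) := h.mp H (h.weakening _ _)

theorem trans (H : D (a ⇒ₑ b)) (K : D (b ⇒ₑ c)) : D (a ⇒ₑ c) :=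
  h.mp K (h.mp H (h.suffixing _ _ _))

theorem id (a) : D (a ⇒ₑ a) := h.mp h.one (h.swap (h.weakening a .one))

theorem imp_anti (c) (H : D (a ⇒ₑ b)) : D ((b ⇒ₑ c) ⇒ₑ (a ⇒ₑ c)) := h.mp H (h.suffixing _ _ _)

theorem prefixing (a b c) : D ((b ⇒ₑ c) ⇒ₑ ((a ⇒ₑ b) ⇒ₑ (a ⇒ₑ c))) := h.swap (h.suffixing _ _ _)

theorem imp_mono (a) (H : D (b ⇒ₑ c)) : D ((a ⇒ₑ b) ⇒ₑ (a ⇒ₑ c)) := h.mp H (h.prefixing _ _ _)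

theorem apply_imp (a b) : D (a ⇒ₑ ((a ⇒ₑ b) ⇒ₑ b)) := h.swap (h.id _)

theorem le_and (H : D (a ⇒ₑ b)) (K : D (a ⇒ₑ c)) : D (a ⇒ₑ (b ∧ₑ c)) :=
  h.mp K (h.mp H (h.and_intro _ _ _))

theorem or_le (H : D (a ⇒ₑ c)) (K : D (b ⇒ₑ c)) : D ((a ∨ₑ b) ⇒ₑ c) :=
  h.mp K (h.mp H (h.or_elim _ _ _))

theorem mul_le (H : D (a ⇒ₑ (b ⇒ₑ c))) : D ((a *ₑ b) ⇒ₑ c) := h.mp H (h.mul_elim _ _ _)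

theorem of_mul_le (H : D ((a *ₑ b) ⇒ₑ c)) : D (a ⇒ₑ (b ⇒ₑ c)) :=
  h.trans (h.mul_intro a b) (h.imp_mono b H)

theorem le_neg (H : D (a ⇒ₑ (b ⇒ₑ .zero))) : D (a ⇒ₑ ¬ₑb) := h.trans H (h.imp_neg b)

theorem of_le_neg (H : D (a ⇒ₑ ¬ₑb)) : D (a ⇒ₑ (b ⇒ₑ .zero)) := h.trans H (h.neg_imp b)

theorem le_neg_comm (H : D (a ⇒ₑ ¬ₑb)) : D (b ⇒ₑ ¬ₑa) := h.le_neg (h.swap (h.of_le_neg H))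

theorem le_neg_neg (a) : D (a ⇒ₑ ¬ₑ¬ₑa) := h.le_neg_comm (h.id _)

theorem neg_neg_le (a) : D (¬ₑ¬ₑa ⇒ₑ a) :=
  h.trans (h.trans (h.neg_imp _) (h.imp_anti _ (h.imp_neg a))) (h.imp_zero_imp_zero a)

theorem neg_anti (H : D (a ⇒ₑ b)) : D (¬ₑb ⇒ₑ ¬ₑa) := h.le_neg_comm (h.trans H (h.le_neg_neg b))

theorem contrapose (a b) : D ((a ⇒ₑ b) ⇒ₑ (¬ₑb ⇒ₑ ¬ₑa)) :=
  h.trans (h.trans (h.suffixing a b .zero) (h.imp_mono _ (h.imp_neg a)))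
    (h.imp_anti _ (h.neg_imp b))

theorem contrapose_symm (a b) : D ((¬ₑb ⇒ₑ ¬ₑa) ⇒ₑ (a ⇒ₑ b)) :=
  h.trans (h.trans (h.contrapose _ _) (h.imp_anti _ (h.le_neg_neg a)))
    (h.imp_mono _ (h.neg_neg_le b))

theorem mul_imp_neg_imp_neg (a b) : D ((a *ₑ b) ⇒ₑ ¬ₑ(a ⇒ₑ ¬ₑb)) :=
  h.mul_le (h.trans (h.apply_imp a (¬ₑb))
    (h.trans (h.imp_mono _ (h.neg_imp b)) (h.trans (h.exchange _ _ _) (h.imp_mono _ (h.imp_neg _)))))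

theorem neg_imp_neg_imp_mul (a b) : D (¬ₑ(a ⇒ₑ ¬ₑb) ⇒ₑ (a *ₑ b)) :=
  h.trans (h.neg_anti (h.swap (h.trans (h.mul_intro a b) (h.contrapose _ _))))
    (h.neg_neg_le _)

/-! ### Provable equivalence is a congruence -/

omit h in
/-- Provable equivalence with respect to a theory. -/
def Eqv (D : ExpFormula → Prop) (a b : ExpFormula) : Prop := D (a ⇒ₑ b) ∧ D (b ⇒ₑ a)

theorem eqv_refl (a) : Eqv D a a := ⟨h.id a, h.id a⟩

theorem eqv_trans (H : Eqv D a b) (K : Eqv D b c) : Eqv D a c :=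
  ⟨h.trans H.1 K.1, h.trans K.2 H.2⟩

theorem and_mono (H : D (a ⇒ₑ b)) (K : D (c ⇒ₑ d)) : D ((a ∧ₑ c) ⇒ₑ (b ∧ₑ d)) :=
  h.le_and (h.trans (h.and_left _ _) H) (h.trans (h.and_right _ _) K)

theorem or_mono (H : D (a ⇒ₑ b)) (K : D (c ⇒ₑ d)) : D ((a ∨ₑ c) ⇒ₑ (b ∨ₑ d)) :=
  h.or_le (h.trans H (h.or_left _ _)) (h.trans K (h.or_right _ _))

theorem mul_mono (H : D (a ⇒ₑ b)) (K : D (c ⇒ₑ d)) : D ((a *ₑ c) ⇒ₑ (b *ₑ d)) :=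
  h.mul_le (h.trans H (h.trans (h.mul_intro b d) (h.imp_anti _ K)))

theorem eqv_and (H : Eqv D a b) (K : Eqv D c d) : Eqv D (a ∧ₑ c) (b ∧ₑ d) :=
  ⟨h.and_mono H.1 K.1, h.and_mono H.2 K.2⟩

theorem eqv_or (H : Eqv D a b) (K : Eqv D c d) : Eqv D (a ∨ₑ c) (b ∨ₑ d) :=
  ⟨h.or_mono H.1 K.1, h.or_mono H.2 K.2⟩

theorem eqv_mul (H : Eqv D a b) (K : Eqv D c d) : Eqv D (a *ₑ c) (b *ₑ d) :=
  ⟨h.mul_mono H.1 K.1, h.mul_mono H.2 K.2⟩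

theorem eqv_imp (H : Eqv D a b) (K : Eqv D c d) : Eqv D (a ⇒ₑ c) (b ⇒ₑ d) :=
  ⟨h.trans (h.imp_anti _ H.2) (h.imp_mono _ K.1), h.trans (h.imp_anti _ H.1) (h.imp_mono _ K.2)⟩

theorem eqv_neg (H : Eqv D a b) : Eqv D (¬ₑa) (¬ₑb) := ⟨h.neg_anti H.2, h.neg_anti H.1⟩

end IsTheory

/-! ### The two languages as parts of the expanded language -/

/-- The inclusion of the language of `S` into the expanded language. -/
def ExpFormula.ofS : SFormula → ExpFormula
  | .var n => .var n
  | .and φ ψ => .and (ofS φ) (ofS ψ)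
  | .or φ ψ => .or (ofS φ) (ofS ψ)
  | .imp φ ψ => .imp (ofS φ) (ofS ψ)
  | .neg φ => .neg (ofS φ)
  | .zero => .zero

/-- The inclusion of the language of `S′` into the expanded language. -/
def ExpFormula.ofSPrime : SPrimeFormula → ExpFormula
  | .var n => .var n
  | .and φ ψ => .and (ofSPrime φ) (ofSPrime ψ)
  | .or φ ψ => .or (ofSPrime φ) (ofSPrime ψ)
  | .mul φ ψ => .mul (ofSPrime φ) (ofSPrime ψ)
  | .imp φ ψ => .imp (ofSPrime φ) (ofSPrime ψ)
  | .zero => .zero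
  | .one => .one

theorem ExpFormula.toS_ofS (φ : SFormula) : (ofS φ).toS = φ := by
  induction φ <;> simp_all [ofS, toS]

namespace IsTheory

variable {D : ExpFormula → Prop} (h : IsTheory D)
include h

theorem eqv_ofS_toS (φ : ExpFormula) : Eqv D φ (.ofS φ.toS) := by
  induction φ with
  | var n => exact h.eqv_refl _
  | and φ ψ ih₁ ih₂ => exact h.eqv_and ih₁ ih₂
  | or φ ψ ih₁ ih₂ => exact h.eqv_or ih₁ ih₂
  | imp φ ψ ih₁ ih₂ => exact h.eqv_imp ih₁ ih₂
  | mul φ ψ ih₁ ih₂ =>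
    exact h.eqv_trans (h.eqv_mul ih₁ ih₂)
      ⟨h.mul_imp_neg_imp_neg _ _, h.neg_imp_neg_imp_mul _ _⟩
  | neg φ ih => exact h.eqv_neg ih
  | zero => exact h.eqv_refl _
  | one => exact ⟨h.wk _ (h.mp (h.id _) (h.imp_neg _)), h.wk _ h.one⟩

theorem eqv_ofSPrime_toSPrime (φ : ExpFormula) : Eqv D φ (.ofSPrime φ.toSPrime) := by
  induction φ with
  | var n => exact h.eqv_refl _
  | and φ ψ ih₁ ih₂ => exact h.eqv_and ih₁ ih₂
  | or φ ψ ih₁ ih₂ => exact h.eqv_or ih₁ ih₂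
  | imp φ ψ ih₁ ih₂ => exact h.eqv_imp ih₁ ih₂
  | mul φ ψ ih₁ ih₂ => exact h.eqv_mul ih₁ ih₂
  | neg φ ih =>
    exact h.eqv_trans ⟨h.neg_imp _, h.imp_neg _⟩ (h.eqv_imp ih (h.eqv_refl .zero))
  | zero => exact h.eqv_refl _
  | one => exact h.eqv_refl _

/-! ### Theories are closed under the rules of `S` -/

theorem impList_mono (Γ : List SFormula) {φ ψ : SFormula} (H : D (.ofS φ ⇒ₑ .ofS ψ)) :
    D (.ofS (.impList Γ φ) ⇒ₑ .ofS (.impList Γ ψ)) := by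
  induction Γ with
  | nil => exact H
  | cons γ Γ ih => exact h.imp_mono _ ih

theorem impList_of_le (Γ : List SFormula) {φ ψ : SFormula} (K : D (.ofS (.impList Γ φ)))
    (H : D (.ofS φ ⇒ₑ .ofS ψ)) : D (.ofS (.impList Γ ψ)) :=
  h.mp K (h.impList_mono Γ H)

theorem impList_and (Γ : List SFormula) (φ ψ : SFormula) :
    D ((.ofS (.impList Γ φ) ∧ₑ .ofS (.impList Γ ψ)) ⇒ₑ .ofS (.impList Γ (φ ∧ₛ ψ))) := by
  induction Γ with
  | nil => exact h.id _
  | cons γ Γ ih =>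
    exact h.trans (h.of_mul_le (h.le_and (h.mul_le (h.and_left _ _)) (h.mul_le (h.and_right _ _))))
      (h.imp_mono _ ih)

theorem imp2_mono {a b c : ExpFormula} (H : D (b ⇒ₑ c)) :
    D ((a ⇒ₑ (a ⇒ₑ b)) ⇒ₑ (a ⇒ₑ (a ⇒ₑ c))) :=
  h.imp_mono _ (h.imp_mono _ H)

/-- Since `a² ≤ a⁴` for every `a`, the hypothesis `a²` can be used twice. -/
theorem imp2_mul (a b c : ExpFormula) :
    D ((a ⇒ₑ (a ⇒ₑ b)) ⇒ₑ ((a ⇒ₑ (a ⇒ₑ c)) ⇒ₑ (a ⇒ₑ (a ⇒ₑ (b *ₑ c))))) := by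
  -- From `b` and `a² ⇒ c` one gets `a² ⇒ b * c`; composing with `a² ⇒ b` costs a second `a²`.
  have h₁ : D ((a ⇒ₑ (a ⇒ₑ c)) ⇒ₑ (b ⇒ₑ (a ⇒ₑ (a ⇒ₑ (b *ₑ c))))) :=
    h.swap (h.trans (h.mul_intro b c)
      (h.trans (h.prefixing a _ _) (h.prefixing a _ _)))
  have h₂ : D ((a ⇒ₑ (a ⇒ₑ c)) ⇒ₑ
      ((a ⇒ₑ (a ⇒ₑ b)) ⇒ₑ (a ⇒ₑ (a ⇒ₑ (a ⇒ₑ (a ⇒ₑ (b *ₑ c))))))) :=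
    h.trans h₁ (h.trans (h.prefixing a _ _) (h.prefixing a _ _))
  have h₃ : D ((a ⇒ₑ (a ⇒ₑ (a ⇒ₑ (a ⇒ₑ (b *ₑ c))))) ⇒ₑ (a ⇒ₑ (a ⇒ₑ (b *ₑ c)))) :=
    h.trans (h.contraction _ _) (h.contraction _ _)
  exact h.swap (h.trans h₂ (h.imp_mono _ h₃))

theorem imp2List_mono (Γ : List SFormula) {φ ψ : SFormula} (H : D (.ofS φ ⇒ₑ .ofS ψ)) :
    D (.ofS (.imp2List Γ φ) ⇒ₑ .ofS (.imp2List Γ ψ)) := by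
  induction Γ with
  | nil => exact H
  | cons γ Γ ih => exact h.imp2_mono ih

theorem imp2List_mul (Γ : List SFormula) (φ ψ : SFormula) :
    D (.ofS (.imp2List Γ φ) ⇒ₑ (.ofS (.imp2List Γ ψ) ⇒ₑ .ofS (.imp2List Γ (.mul φ ψ)))) := by
  induction Γ with
  | nil => exact h.of_mul_le (h.mul_imp_neg_imp_neg _ _)
  | cons γ Γ ih =>
    exact h.trans (h.imp2_mul _ _ _)
      (h.imp_mono _ (h.imp2_mono (h.mul_le ih)))

/-- Each of the eight monomials of `(a ∨ b)³` contains `a²` or `b²`. -/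
theorem or_imp2 {a b c : ExpFormula} (H : D (a ⇒ₑ (a ⇒ₑ c))) (K : D (b ⇒ₑ (b ⇒ₑ c))) :
    D ((a ∨ₑ b) ⇒ₑ ((a ∨ₑ b) ⇒ₑ c)) := by
  have key : ∀ {x y : ExpFormula}, D (x ⇒ₑ (x ⇒ₑ c)) → D (x ⇒ₑ (y ⇒ₑ (x ⇒ₑ c))) :=
    fun {x y} hx => h.swap (h.wk y hx)
  have haa : D (a ⇒ₑ (a ⇒ₑ ((a ∨ₑ b) ⇒ₑ c))) :=
    h.trans H (h.imp_mono _ (h.weakening _ _))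
  have hbb : D (b ⇒ₑ (b ⇒ₑ ((a ∨ₑ b) ⇒ₑ c))) :=
    h.trans K (h.imp_mono _ (h.weakening _ _))
  have hab : D (a ⇒ₑ (b ⇒ₑ ((a ∨ₑ b) ⇒ₑ c))) :=
    h.of_mul_le (h.swap (h.or_le
      (h.swap (h.mul_le (key H)))
      (h.swap (h.mul_le (h.wk a K)))))
  exact h.mp (h.or_le (h.swap (h.or_le haa (h.swap hab))) (h.swap (h.or_le hab hbb)))
    (h.contraction _ _)

theorem of_sDerives {T : Set SFormula} (hT : ∀ φ ∈ T, D (.ofS φ)) {φ : SFormula}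
    (H : SDerives T φ) : D (.ofS φ) := by
  induction H with
  | hyp H => exact hT _ H
  | A1 φ => exact h.id _
  | A2 ψ => exact h.zero_imp _
  | A3 φ => exact h.neg_imp _
  | A4 => exact h.mp (h.id _) (h.imp_neg _)
  | A5 φ ψ =>
    exact h.mp h.one (h.le_and (h.wk _ (h.contrapose _ _)) (h.wk _ (h.contrapose_symm _ _)))
  | P Γ _ ih => exact h.impList_of_le Γ ih (h.exchange _ _ _)
  | C _ ih => exact h.mp ih (h.contraction _ _)
  | E Γ _ _ ih₁ ih₂ => exact h.impList_of_le Γ ih₁ ih₂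
  | impL Γ _ _ ih₁ ih₂ =>
    exact h.impList_of_le Γ ih₁ (h.trans (h.apply_imp _ _) (h.imp_mono _ ih₂))
  | impR φ _ ih => exact h.wk _ ih
  | andL1 ψ _ ih => exact h.trans (h.and_left _ _) ih
  | andL2 φ _ ih => exact h.trans (h.and_right _ _) ih
  | andR Γ _ _ ih₁ ih₂ =>
    exact h.mp (h.mp h.one (h.le_and (h.wk _ ih₁) (h.wk _ ih₂))) (h.impList_and Γ _ _)
  | orL1 _ _ ih₁ ih₂ => exact h.or_le ih₁ ih₂
  | orL2 _ _ ih₁ ih₂ => exact h.or_imp2 ih₁ ih₂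
  | orR1 Γ ψ _ ih => exact h.impList_of_le Γ ih (h.or_left _ _)
  | orR2 Γ φ _ ih => exact h.impList_of_le Γ ih (h.or_right _ _)
  | negImpL _ ih =>
    -- `¬(φ ⇒ ψ) ≤ φ` by ex falso, and `¬(φ ⇒ ψ) ≤ ¬ψ` by weakening.
    refine h.trans (h.le_and ?_ (h.neg_anti (h.weakening _ _))) ih
    exact h.trans (h.neg_anti (h.trans (h.neg_imp _) (h.imp_mono _ (h.zero_imp _))))
      (h.neg_neg_le _)
  | negImpR Γ _ ih =>
    refine h.mp (h.mp ih (h.mp ih (h.imp2List_mul Γ _ _))) (h.imp2List_mono Γ ?_)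
    refine h.trans (h.neg_imp_neg_imp_mul _ _) (h.trans
      (h.mul_mono (h.and_left _ _) (h.and_right _ _)) ?_)
    exact h.trans (h.mul_imp_neg_imp_neg _ _) (h.neg_anti (h.imp_mono _ (h.le_neg_neg _)))
  | negAndL _ ih =>
    refine h.trans (h.trans (h.neg_anti ?_) (h.neg_neg_le _)) ih
    exact h.le_and (h.trans (h.neg_anti (h.or_left _ _)) (h.neg_neg_le _))
      (h.trans (h.neg_anti (h.or_right _ _)) (h.neg_neg_le _))
  | negAndR Γ _ ih =>
    exact h.impList_of_le Γ ih
      (h.or_le (h.neg_anti (h.and_left _ _)) (h.neg_anti (h.and_right _ _)))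
  | negOrL _ ih =>
    exact h.trans (h.le_and (h.neg_anti (h.or_left _ _)) (h.neg_anti (h.or_right _ _))) ih
  | negOrR Γ _ ih =>
    exact h.impList_of_le Γ ih
      (h.le_neg_comm (h.or_le (h.le_neg_comm (h.and_left _ _)) (h.le_neg_comm (h.and_right _ _))))
  | negNegL _ ih => exact h.trans (h.neg_neg_le _) ih
  | negNegR Γ _ ih => exact h.impList_of_le Γ ih (h.le_neg_neg _)

end IsTheory

/-! ### The schemata of `S′` are derivable in `S` -/

namespace SDerives

variable {T : Set SFormula} {a b c : SFormula}

theorem mp (H : SDerives T a) (K : SDerives T (a ⇒ₛ b)) : SDerives T b := E [] H K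

theorem swap (H : SDerives T (a ⇒ₛ b ⇒ₛ c)) : SDerives T (b ⇒ₛ a ⇒ₛ c) := P [] H

theorem trans (H : SDerives T (a ⇒ₛ b)) (K : SDerives T (b ⇒ₛ c)) : SDerives T (a ⇒ₛ c) :=
  E [a] H K

theorem apply_imp (a b : SFormula) : SDerives T (a ⇒ₛ (a ⇒ₛ b) ⇒ₛ b) := swap (A1 _)

theorem suffixing (a b c : SFormula) : SDerives T ((a ⇒ₛ b) ⇒ₛ (b ⇒ₛ c) ⇒ₛ a ⇒ₛ c) :=
  P [a ⇒ₛ b] (impL [a ⇒ₛ b, a] (A1 _) (A1 _))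

theorem exchange (a b c : SFormula) : SDerives T ((a ⇒ₛ b ⇒ₛ c) ⇒ₛ b ⇒ₛ a ⇒ₛ c) :=
  P [a ⇒ₛ b ⇒ₛ c] (A1 _)

theorem weakening (a b : SFormula) : SDerives T (a ⇒ₛ b ⇒ₛ a) := swap (impR _ (A1 _))

theorem imp_mono (a : SFormula) (H : SDerives T (b ⇒ₛ c)) :
    SDerives T ((a ⇒ₛ b) ⇒ₛ a ⇒ₛ c) := E [a ⇒ₛ b, a] (A1 _) H

theorem imp_anti (c : SFormula) (H : SDerives T (a ⇒ₛ b)) :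
    SDerives T ((b ⇒ₛ c) ⇒ₛ a ⇒ₛ c) := mp H (suffixing _ _ _)

theorem le_neg_neg (a : SFormula) : SDerives T (a ⇒ₛ ¬ₛ¬ₛa) := negNegR [a] (A1 _)

theorem neg_neg_le (a : SFormula) : SDerives T (¬ₛ¬ₛa ⇒ₛ a) := negNegL (A1 _)

theorem contrapose (a b : SFormula) : SDerives T ((a ⇒ₛ b) ⇒ₛ ¬ₛb ⇒ₛ ¬ₛa) :=
  mp (A5 a b) (andL1 _ (A1 _))

theorem mul_intro (a b : SFormula) : SDerives T (a ⇒ₛ b ⇒ₛ .mul a b) :=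
  trans (apply_imp a (¬ₛb)) (trans (contrapose _ _) (imp_anti _ (le_neg_neg b)))

theorem mul_elim (a b c : SFormula) : SDerives T ((a ⇒ₛ b ⇒ₛ c) ⇒ₛ .mul a b ⇒ₛ c) :=
  trans (imp_mono a (contrapose b c)) (trans (exchange _ _ _)
    (trans (contrapose _ _) (imp_mono _ (neg_neg_le c))))

theorem and_left (a b : SFormula) : SDerives T (a ∧ₛ b ⇒ₛ a) := andL1 _ (A1 _)

theorem and_right (a b : SFormula) : SDerives T (a ∧ₛ b ⇒ₛ b) := andL2 _ (A1 _)

theorem and_intro (a b c : SFormula) :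
    SDerives T ((a ⇒ₛ b) ⇒ₛ (a ⇒ₛ c) ⇒ₛ a ⇒ₛ b ∧ₛ c) :=
  andR [a ⇒ₛ b, a ⇒ₛ c, a] (trans (imp_mono _ (weakening _ _)) (exchange _ _ _))
    (impR _ (A1 _))

theorem or_left (a b : SFormula) : SDerives T (a ⇒ₛ a ∨ₛ b) := orR1 [a] _ (A1 _)

theorem or_right (a b : SFormula) : SDerives T (b ⇒ₛ a ∨ₛ b) := orR2 [b] _ (A1 _)

theorem or_elim (a b c : SFormula) :
    SDerives T ((a ⇒ₛ c) ⇒ₛ (b ⇒ₛ c) ⇒ₛ a ∨ₛ b ⇒ₛ c) :=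
  -- Left introduction of `∨` has no side formulas, so the two implications are first moved
  -- to the right of `a ∨ b`.
  P [a ⇒ₛ c] (swap (orL1 (trans (apply_imp a c) (imp_mono _ (weakening _ _)))
    (swap (impR _ (apply_imp b c)))))

theorem imp_neg (a : SFormula) : SDerives T ((a ⇒ₛ .zero) ⇒ₛ ¬ₛa) :=
  mp A4 (swap (contrapose _ _))

theorem imp_zero_imp_zero (a : SFormula) : SDerives T (((a ⇒ₛ .zero) ⇒ₛ .zero) ⇒ₛ a) :=
  trans (imp_anti _ (A3 a)) (trans (imp_neg _) (neg_neg_le a))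

/-- The contraction rule yields `a ⇒ (a ⇒ a³)`, and `a ⇒ (a ⇒ (a ⇒ b))` entails `a³ ⇒ b`. -/
theorem contraction (a b : SFormula) :
    SDerives T ((a ⇒ₛ a ⇒ₛ a ⇒ₛ b) ⇒ₛ a ⇒ₛ a ⇒ₛ b) := by
  have cube : SDerives T (a ⇒ₛ a ⇒ₛ .mul a (.mul a a)) :=
    C (E [a, a] (mul_intro a a) (swap (mul_intro a (.mul a a))))
  have cube_elim : SDerives T ((a ⇒ₛ a ⇒ₛ a ⇒ₛ b) ⇒ₛ .mul a (.mul a a) ⇒ₛ b) :=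
    trans (imp_mono a (mul_elim a a b)) (mul_elim _ _ _)
  exact swap (P [a] (E [a, a] cube (swap cube_elim)))

end SDerives

/-! ### The two consequence relations -/

theorem SConsequence.isTheory (T : Set ExpFormula) : IsTheory (SConsequence T) where
  mp := SDerives.mp
  suffixing _ _ _ := SDerives.suffixing _ _ _
  exchange _ _ _ := SDerives.exchange _ _ _
  weakening _ _ := SDerives.weakening _ _
  mul_intro _ _ := SDerives.mul_intro _ _
  mul_elim _ _ _ := SDerives.mul_elim _ _ _
  and_left _ _ := SDerives.and_left _ _
  and_right _ _ := SDerives.and_right _ _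
  and_intro _ _ _ := SDerives.and_intro _ _ _
  or_left _ _ := SDerives.or_left _ _
  or_right _ _ := SDerives.or_right _ _
  or_elim _ _ _ := SDerives.or_elim _ _ _
  one := SDerives.A4
  zero_imp _ := SDerives.A2 _
  imp_zero_imp_zero _ := SDerives.imp_zero_imp_zero _
  contraction _ _ := SDerives.contraction _ _
  neg_imp _ := SDerives.A3 _
  imp_neg _ := SDerives.imp_neg _

/-- The substitution of three formulas for the first three variables, in which all schemata are
written. -/
def instThree {F : Type} (a b c : F) : ℕ → F
  | 0 => a
  | 1 => b
  | _ => c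

theorem SPrimeConsequence.isTheory (T : Set ExpFormula) : IsTheory (SPrimeConsequence T) := by
  have ax : ∀ (a b c : ExpFormula) {α : SPrimeFormula}, α ∈ sPrimeSchemata →
      SPrimeDerives (ExpFormula.toSPrime '' T)
        (α.subst (instThree a.toSPrime b.toSPrime c.toSPrime)) :=
    fun a b c α hα => .ax ⟨α, hα, _, rfl⟩
  -- Both schemata for `¬` are read as instances of `a ⇒ a`, which is not among the axioms of `S′`.
  have refl : ∀ a : SPrimeFormula,
      SPrimeDerives (ExpFormula.toSPrime '' T) (a ⇒ₚ a) := fun a =>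
    .mp (.ax ⟨.one, by simp [sPrimeSchemata], instThree a a a, rfl⟩)
      (.mp (.ax ⟨.var 0 ⇒ₚ (.var 1 ⇒ₚ .var 0), by simp [sPrimeSchemata],
          instThree a .one a, rfl⟩)
        (.ax ⟨(.var 0 ⇒ₚ (.var 1 ⇒ₚ .var 2)) ⇒ₚ (.var 1 ⇒ₚ (.var 0 ⇒ₚ .var 2)),
          by simp [sPrimeSchemata], instThree a .one a, rfl⟩))
  let p : SPrimeFormula := .var 0
  let q : SPrimeFormula := .var 1
  let r : SPrimeFormula := .var 2
  exact
  { mp := .mp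
    suffixing a b c := ax a b c (α := (p ⇒ₚ q) ⇒ₚ ((q ⇒ₚ r) ⇒ₚ (p ⇒ₚ r)))
      (by simp [sPrimeSchemata, p, q, r])
    exchange a b c := ax a b c (α := (p ⇒ₚ (q ⇒ₚ r)) ⇒ₚ (q ⇒ₚ (p ⇒ₚ r)))
      (by simp [sPrimeSchemata, p, q, r])
    weakening a b := ax a b b (α := p ⇒ₚ (q ⇒ₚ p)) (by simp [sPrimeSchemata, p, q])
    mul_intro a b := ax a b b (α := p ⇒ₚ (q ⇒ₚ (p *ₚ q))) (by simp [sPrimeSchemata, p, q])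
    mul_elim a b c := ax a b c (α := (p ⇒ₚ (q ⇒ₚ r)) ⇒ₚ ((p *ₚ q) ⇒ₚ r))
      (by simp [sPrimeSchemata, p, q, r])
    and_left a b := ax a b b (α := (p ∧ₚ q) ⇒ₚ p) (by simp [sPrimeSchemata, p, q])
    and_right a b := ax a b b (α := (p ∧ₚ q) ⇒ₚ q) (by simp [sPrimeSchemata, p, q])
    and_intro a b c := ax a b c (α := (p ⇒ₚ q) ⇒ₚ ((p ⇒ₚ r) ⇒ₚ (p ⇒ₚ (q ∧ₚ r))))
      (by simp [sPrimeSchemata, p, q, r])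
    or_left a b := ax a b b (α := p ⇒ₚ (p ∨ₚ q)) (by simp [sPrimeSchemata, p, q])
    or_right a b := ax a b b (α := q ⇒ₚ (p ∨ₚ q)) (by simp [sPrimeSchemata, p, q])
    or_elim a b c := ax a b c (α := (p ⇒ₚ r) ⇒ₚ ((q ⇒ₚ r) ⇒ₚ ((p ∨ₚ q) ⇒ₚ r)))
      (by simp [sPrimeSchemata, p, q, r])
    one := ax .one .one .one (α := .one) (by simp [sPrimeSchemata])
    zero_imp a := ax a a a (α := .zero ⇒ₚ p) (by simp [sPrimeSchemata, p])
    imp_zero_imp_zero a := ax a a a (α := ((p ⇒ₚ .zero) ⇒ₚ .zero) ⇒ₚ p)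
      (by simp [sPrimeSchemata, p])
    contraction a b := ax a b b (α := (p ⇒ₚ (p ⇒ₚ (p ⇒ₚ q))) ⇒ₚ (p ⇒ₚ (p ⇒ₚ q)))
      (by simp [sPrimeSchemata, p, q])
    neg_imp a := refl _
    imp_neg a := refl _ }

theorem IsTheory.of_sPrimeDerives {D : ExpFormula → Prop} (h : IsTheory D) {T : Set SPrimeFormula}
    (hT : ∀ φ ∈ T, D (.ofSPrime φ)) {φ : SPrimeFormula} (H : SPrimeDerives T φ) :
    D (.ofSPrime φ) := by
  induction H with
  | hyp H => exact hT _ H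
  | mp _ _ ih₁ ih₂ => exact h.mp ih₁ ih₂
  | ax H =>
    obtain ⟨α, hα, σ, rfl⟩ := H
    simp only [sPrimeSchemata, Set.mem_insert_iff, Set.mem_singleton_iff] at hα
    rcases hα with rfl | rfl | rfl | rfl | rfl | rfl | rfl | rfl | rfl | rfl | rfl | rfl | rfl |
      rfl | rfl
    · exact h.suffixing _ _ _
    · exact h.exchange _ _ _
    · exact h.weakening _ _
    · exact h.mul_intro _ _
    · exact h.mul_elim _ _ _
    · exact h.and_left _ _
    · exact h.and_right _ _
    · exact h.and_intro _ _ _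
    · exact h.or_left _ _
    · exact h.or_right _ _
    · exact h.or_elim _ _ _
    · exact h.one
    · exact h.zero_imp _
    · exact h.imp_zero_imp_zero _
    · exact h.contraction _ _

theorem sConsequence_iff_sPrimeConsequence (T : Set ExpFormula) (φ : ExpFormula) :
    SConsequence T φ ↔ SPrimeConsequence T φ := by
  constructor
  · intro H
    have h := SPrimeConsequence.isTheory T
    refine h.mp (h.of_sDerives ?_ H) (h.eqv_ofS_toS φ).2
    rintro _ ⟨ψ, hψ, rfl⟩
    exact h.mp (MPDerives.hyp ⟨ψ, hψ, rfl⟩) (h.eqv_ofS_toS ψ).1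
  · intro H
    have h := SConsequence.isTheory T
    refine h.mp (h.of_sPrimeDerives ?_ H) (h.eqv_ofSPrime_toSPrime φ).2
    rintro _ ⟨ψ, hψ, rfl⟩
    exact h.mp (SDerives.hyp ⟨ψ, hψ, rfl⟩) (h.eqv_ofSPrime_toSPrime ψ).1

/-! ### A finite axiomatization of `S` with modus ponens -/

/-- The fifteen schemata of `S′`, with `*` and `1` read as abbreviations in the language of `S`,
and the two halves of `¬φ ⇔ (φ ⇒ 0)`, written with the variables `var 0`, `var 1`, `var 2`. -/
def nelsonSchemata : Set SFormula :=
  let φ : SFormula := .var 0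
  let ψ : SFormula := .var 1
  let γ : SFormula := .var 2
  { (φ ⇒ₛ ψ) ⇒ₛ ((ψ ⇒ₛ γ) ⇒ₛ (φ ⇒ₛ γ)),
    (φ ⇒ₛ (ψ ⇒ₛ γ)) ⇒ₛ (ψ ⇒ₛ (φ ⇒ₛ γ)),
    φ ⇒ₛ (ψ ⇒ₛ φ),
    φ ⇒ₛ (ψ ⇒ₛ .mul φ ψ),
    (φ ⇒ₛ (ψ ⇒ₛ γ)) ⇒ₛ (.mul φ ψ ⇒ₛ γ),
    (φ ∧ₛ ψ) ⇒ₛ φ,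
    (φ ∧ₛ ψ) ⇒ₛ ψ,
    (φ ⇒ₛ ψ) ⇒ₛ ((φ ⇒ₛ γ) ⇒ₛ (φ ⇒ₛ (ψ ∧ₛ γ))),
    φ ⇒ₛ (φ ∨ₛ ψ),
    ψ ⇒ₛ (φ ∨ₛ ψ),
    (φ ⇒ₛ γ) ⇒ₛ ((ψ ⇒ₛ γ) ⇒ₛ ((φ ∨ₛ ψ) ⇒ₛ γ)),
    .one,
    .zero ⇒ₛ φ,
    ((φ ⇒ₛ .zero) ⇒ₛ .zero) ⇒ₛ φ,
    (φ ⇒ₛ (φ ⇒ₛ (φ ⇒ₛ ψ))) ⇒ₛ (φ ⇒ₛ (φ ⇒ₛ ψ)),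
    ¬ₛφ ⇒ₛ (φ ⇒ₛ .zero),
    (φ ⇒ₛ .zero) ⇒ₛ ¬ₛφ }

theorem nelsonSchemata_finite : nelsonSchemata.Finite := by
  simp only [nelsonSchemata]
  exact Set.toFinite _

theorem SDerives.of_nelsonSchemata {T : Set SFormula} {α : SFormula} (hα : α ∈ nelsonSchemata)
    (σ : ℕ → SFormula) : SDerives T (α.subst σ) := by
  simp only [nelsonSchemata, Set.mem_insert_iff, Set.mem_singleton_iff] at hα
  rcases hα with rfl | rfl | rfl | rfl | rfl | rfl | rfl | rfl | rfl | rfl | rfl | rfl | rfl |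
    rfl | rfl | rfl | rfl
  · exact suffixing _ _ _
  · exact exchange _ _ _
  · exact weakening _ _
  · exact mul_intro _ _
  · exact mul_elim _ _ _
  · exact and_left _ _
  · exact and_right _ _
  · exact and_intro _ _ _
  · exact or_left _ _
  · exact or_right _ _
  · exact or_elim _ _ _
  · exact A4
  · exact A2 _
  · exact imp_zero_imp_zero _
  · exact contraction _ _
  · exact A3 _
  · exact imp_neg _

theorem isTheory_mpDerives_nelsonSchemata (T : Set SFormula) :
    IsTheory fun φ => MPDerives SFormula.imp {χ | ∃ α ∈ nelsonSchemata, ∃ σ, χ = α.subst σ} T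
      φ.toS := by
  have ax : ∀ (a b c : ExpFormula) {α : SFormula}, α ∈ nelsonSchemata →
      MPDerives SFormula.imp {χ | ∃ α ∈ nelsonSchemata, ∃ σ, χ = α.subst σ} T
        (α.subst (instThree a.toS b.toS c.toS)) :=
    fun a b c α hα => .ax ⟨α, hα, _, rfl⟩
  let p : SFormula := .var 0
  let q : SFormula := .var 1
  let r : SFormula := .var 2
  exact
  { mp := .mp
    suffixing a b c := ax a b c (α := (p ⇒ₛ q) ⇒ₛ ((q ⇒ₛ r) ⇒ₛ (p ⇒ₛ r)))
      (by simp [nelsonSchemata, p, q, r])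
    exchange a b c := ax a b c (α := (p ⇒ₛ (q ⇒ₛ r)) ⇒ₛ (q ⇒ₛ (p ⇒ₛ r)))
      (by simp [nelsonSchemata, p, q, r])
    weakening a b := ax a b b (α := p ⇒ₛ (q ⇒ₛ p)) (by simp [nelsonSchemata, p, q])
    mul_intro a b := ax a b b (α := p ⇒ₛ (q ⇒ₛ .mul p q)) (by simp [nelsonSchemata, p, q])
    mul_elim a b c := ax a b c (α := (p ⇒ₛ (q ⇒ₛ r)) ⇒ₛ (.mul p q ⇒ₛ r))
      (by simp [nelsonSchemata, p, q, r])
    and_left a b := ax a b b (α := (p ∧ₛ q) ⇒ₛ p) (by simp [nelsonSchemata, p, q])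
    and_right a b := ax a b b (α := (p ∧ₛ q) ⇒ₛ q) (by simp [nelsonSchemata, p, q])
    and_intro a b c := ax a b c (α := (p ⇒ₛ q) ⇒ₛ ((p ⇒ₛ r) ⇒ₛ (p ⇒ₛ (q ∧ₛ r))))
      (by simp [nelsonSchemata, p, q, r])
    or_left a b := ax a b b (α := p ⇒ₛ (p ∨ₛ q)) (by simp [nelsonSchemata, p, q])
    or_right a b := ax a b b (α := q ⇒ₛ (p ∨ₛ q)) (by simp [nelsonSchemata, p, q])
    or_elim a b c := ax a b c (α := (p ⇒ₛ r) ⇒ₛ ((q ⇒ₛ r) ⇒ₛ ((p ∨ₛ q) ⇒ₛ r)))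
      (by simp [nelsonSchemata, p, q, r])
    one := ax .one .one .one (α := .one) (by simp [nelsonSchemata])
    zero_imp a := ax a a a (α := .zero ⇒ₛ p) (by simp [nelsonSchemata, p])
    imp_zero_imp_zero a := ax a a a (α := ((p ⇒ₛ .zero) ⇒ₛ .zero) ⇒ₛ p)
      (by simp [nelsonSchemata, p])
    contraction a b := ax a b b (α := (p ⇒ₛ (p ⇒ₛ (p ⇒ₛ q))) ⇒ₛ (p ⇒ₛ (p ⇒ₛ q)))
      (by simp [nelsonSchemata, p, q])
    neg_imp a := ax a a a (α := ¬ₛp ⇒ₛ (p ⇒ₛ .zero)) (by simp [nelsonSchemata, p])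
    imp_neg a := ax a a a (α := (p ⇒ₛ .zero) ⇒ₛ ¬ₛp) (by simp [nelsonSchemata, p]) }

theorem sDerives_iff_mpDerives_nelsonSchemata (T : Set SFormula) (φ : SFormula) :
    SDerives T φ ↔
      MPDerives SFormula.imp {χ | ∃ α ∈ nelsonSchemata, ∃ σ, χ = α.subst σ} T φ := by
  constructor
  · intro H
    have := (isTheory_mpDerives_nelsonSchemata T).of_sDerives
      (fun ψ hψ => .hyp ((ExpFormula.toS_ofS ψ).symm ▸ hψ)) H
    rwa [ExpFormula.toS_ofS] at this
  · intro H
    induction H with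
    | hyp H => exact .hyp H
    | ax H =>
      obtain ⟨α, hα, σ, rfl⟩ := H
      exact .of_nelsonSchemata hα σ
    | mp _ _ ih₁ ih₂ => exact .mp ih₁ ih₂

/-- In the expanded language, `S` and `S′` have the same consequence relation; and `S`, in its own
language, is axiomatized by finitely many axiom schemata with modus ponens as the only rule. -/
theorem mainTheorem4 :
    (∀ (T : Set ExpFormula) (φ : ExpFormula), SConsequence T φ ↔ SPrimeConsequence T φ) ∧
    (∃ A : Set SFormula, A.Finite ∧
      ∀ (T : Set SFormula) (φ : SFormula),
        SDerives T φ ↔ MPDerives SFormula.imp {χ | ∃ α ∈ A, ∃ σ, χ = α.subst σ} T φ) :=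
  ⟨sConsequence_iff_sPrimeConsequence,
    nelsonSchemata, nelsonSchemata_finite, sDerives_iff_mpDerives_nelsonSchemata⟩
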